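/- Let $K$ be a field of characteristic $0$ and let $L$ be a finite-dimensional reductive Lie algebra over $K$ (that is, the radical of $L$ equals its center $Z$). Let $L = Z \oplus L_1 \oplus \cdots \oplus L_k$ ($k \ge 0$) be its decomposition into the direct sum of the center $Z$ and simple ideals $L_1, \dots, L_k$. A linear operator $J$ on $L$ is called Lie-orthogonal if $[Jx, Jy] = [x, y]$ for all $x, y \in L$. Then a linear operator $J$ on $L$ is Lie-orthogonal if and only if it can be represented in the form $$J = J_0 \oplus J_1 \oplus \cdots \oplus J_k + J_Z,$$ where $J_0$ is the zero operator on $Z$, for each $i = 1, \dots, k$ the operator $J_i$ on $L_i$ is either $\mathrm{Id}_{L_i}$ or $-\mathrm{Id}_{L_i}$ (the signs being chosen independently), and $J_Z$ is an arbitrary linear operator on $L$ whose image is contained in the center $Z$. -/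

import Mathlib

/-- A linear operator `J` on a Lie algebra is *Lie-orthogonal* if `[J x, J y] = [x, y]` for all
`x` and `y`. -/
def IsLieOrthogonal {K L : Type*} [CommRing K] [LieRing L] [LieAlgebra K L]
    (J : Module.End K L) : Prop :=
  ∀ x y : L, ⁅J x, J y⁆ = ⁅x, y⁆

/-- The family of ideals consisting of the center (index `none`) and of the given ideals
`S 0, …, S (k - 1)` (indices `some i`). -/
def centerAndComponents (K : Type*) {L : Type*} [CommRing K] [LieRing L] [LieAlgebra K L]
    {k : ℕ} (S : Fin k → LieIdeal K L) : Option (Fin k) → LieIdeal K L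
  | none => LieAlgebra.center K L
  | some i => S i

/-- Given an internal direct sum decomposition `V = ⨁ i, A i` of a vector space and operators
`f i` on `A i`, this is the operator `⨁ i, f i` on `V`: it maps `∑ i, x i` with `x i ∈ A i` to
`∑ i, f i (x i)`. -/
noncomputable def directSumOperator {K V ι : Type*} [CommRing K] [AddCommGroup V] [Module K V]
    [DecidableEq ι] {A : ι → Submodule K V} (hA : DirectSum.IsInternal A)
    (f : ∀ i, Module.End K (A i)) : Module.End K V :=
  let e : (DirectSum ι fun i => A i) ≃ₗ[K] V :=
    LinearEquiv.ofBijective (DirectSum.coeLinearMap A) hA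
  e.toLinearMap ∘ₗ DirectSum.lmap f ∘ₗ e.symm.toLinearMap

/-- `directSumOperator hA f` restricts to `f i` on the summand `A i`. -/
theorem directSumOperator_apply {K V ι : Type*} [CommRing K] [AddCommGroup V] [Module K V]
    [DecidableEq ι] {A : ι → Submodule K V} (hA : DirectSum.IsInternal A)
    (f : ∀ i, Module.End K (A i)) (i : ι) (x : A i) :
    directSumOperator hA f x = f i x := by
  have h : (LinearEquiv.ofBijective (DirectSum.coeLinearMap A) hA).symm (x : V) =
      DirectSum.lof K ι (fun i => A i) i x := by
    rw [LinearEquiv.symm_apply_eq]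
    exact (DirectSum.coeLinearMap_lof A i x).symm
  simp only [directSumOperator, LinearMap.comp_apply, LinearEquiv.coe_coe, h, DirectSum.lmap_lof]
  exact DirectSum.coeLinearMap_lof A i (f i x)

/-! A Lie-orthogonal `J` descends to `L ⧸ Z`, which has trivial radical and so, in characteristic 0,
nondegenerate Killing form. There invariance of the form gives `J ^ 2 = 1`, and Jacobi puts `J` in
the centroid (`IsLieOrthogonal.centroid_involution`). Back in `L`, the `+1` eigenspace of `J` modulo
`Z` meets a simple ideal in an ideal, so it is trivial or everything; this yields the sign. The
converse is checked summand by summand. -/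

theorem LieAlgebra.mem_center_iff_lie_eq_zero {K L : Type*} [CommRing K] [LieRing L]
    [LieAlgebra K L] {x : L} : x ∈ LieAlgebra.center K L ↔ ∀ y : L, ⁅x, y⁆ = 0 := by
  rw [LieModule.mem_maxTrivSubmodule]
  refine forall_congr' fun y => ?_
  rw [← lie_skew, neg_eq_zero]

theorem LieAlgebra.eq_zero_of_forall_lie_eq_zero {K M : Type*} [Field K] [LieRing M]
    [LieAlgebra K M] [FiniteDimensional K M] [LieAlgebra.IsKilling K M] {x : M}
    (h : ∀ y : M, ⁅x, y⁆ = 0) : x = 0 := by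
  have hx := LieAlgebra.mem_center_iff_lie_eq_zero (K := K).mpr h
  rwa [LieAlgebra.center_eq_bot, LieSubmodule.mem_bot] at hx

/-- A Lie-orthogonal operator on a Lie algebra with non-degenerate Killing form is an involution
such that `[J x, y] = [x, J y]`, and the Killing form satisfies `κ([x, J y], z) = κ([x, y], J z)`. -/
theorem IsLieOrthogonal.killingForm_identities {K M : Type*} [Field K] [LieRing M]
    [LieAlgebra K M] [FiniteDimensional K M] [LieAlgebra.IsKilling K M] {J : Module.End K M}
    (hJ : IsLieOrthogonal J) :
    (∀ x : M, J (J x) = x) ∧ (∀ x y : M, ⁅J x, y⁆ = ⁅x, J y⁆) ∧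
      ∀ x y z : M, killingForm K M ⁅x, J y⁆ z = killingForm K M ⁅x, y⁆ (J z) := by
  have hinj : Function.Injective J := by
    rw [injective_iff_map_eq_zero]
    intro x hx
    refine LieAlgebra.eq_zero_of_forall_lie_eq_zero (K := K) fun y => ?_
    rw [← hJ x y, hx, zero_lie]
  let e := LinearEquiv.ofInjectiveEndo J hinj
  let A : Module.End K M := (e.symm : M →ₗ[K] M)
  have hJA (x : M) : J (A x) = x := e.apply_symm_apply x
  have hAJ (x : M) : A (J x) = x := e.symm_apply_apply x
  have hshift (x y : M) : ⁅J x, y⁆ = ⁅x, A y⁆ := by rw [← hJ x (A y), hJA]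
  have hform (x y z : M) : killingForm K M ⁅x, A y⁆ z = killingForm K M ⁅x, y⁆ (A z) := by
    rw [← hshift, LieModule.traceForm_apply_lie_apply', hshift,
      LieModule.traceForm_apply_lie_apply']
  -- By `hform`, both sides pair with `z` to `κ([x, y], A z)`.
  have hsymm (x y : M) : ⁅A x, y⁆ = ⁅x, A y⁆ := by
    refine sub_eq_zero.mp ((LieAlgebra.IsKilling.killingForm_nondegenerate K M).1 _ fun z => ?_)
    rw [map_sub, LinearMap.sub_apply, ← lie_skew, map_neg, LinearMap.neg_apply, hform, hform,
      ← lie_skew x y, map_neg, LinearMap.neg_apply, sub_self]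
  have hA (x : M) : A x = J x := by
    refine sub_eq_zero.mp (LieAlgebra.eq_zero_of_forall_lie_eq_zero (K := K) fun y => ?_)
    rw [sub_lie, hsymm, hshift, sub_self]
  refine ⟨fun x => by rw [← hA x, hJA], fun x y => ?_, fun x y z => ?_⟩
  · rw [← hA x, ← hA y, hsymm]
  · rw [← hA y, ← hA z, hform]

/-- A Lie-orthogonal operator on a Lie algebra with non-degenerate Killing form is an involution in
the centroid. -/
theorem IsLieOrthogonal.centroid_involution {K M : Type*} [Field K] [CharZero K] [LieRing M]
    [LieAlgebra K M] [FiniteDimensional K M] [LieAlgebra.IsKilling K M] {J : Module.End K M}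
    (hJ : IsLieOrthogonal J) :
    (∀ x y : M, J ⁅x, y⁆ = ⁅J x, y⁆) ∧ ∀ x : M, J (J x) = x := by
  obtain ⟨hinv, hsymm, hform⟩ := hJ.killingForm_identities
  refine ⟨fun x y => ?_, hinv⟩
  have jacobi (a b c : M) : ⁅⁅a, b⁆, c⁆ + ⁅⁅b, c⁆, a⁆ + ⁅⁅c, a⁆, b⁆ = 0 := by
    have h := lie_jacobi c a b
    rw [← lie_skew c ⁅a, b⁆, ← lie_skew a ⁅b, c⁆, ← lie_skew b ⁅c, a⁆] at h
    rw [← neg_eq_zero, ← h]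
    abel
  -- Jacobi for `a, b, J c`, with `J` moved across brackets.
  have key (a b c : M) : ⁅J ⁅a, b⁆, c⁆ + ⁅⁅J c, a⁆, b⁆ + ⁅⁅J b, c⁆, a⁆ = 0 := by
    rw [hsymm, hsymm b c, ← jacobi a b (J c)]
    abel
  -- Paired with `w`, every `J` moves onto `w`, leaving the Jacobi sum.
  have hcyc (z : M) : ⁅J ⁅x, y⁆, z⁆ + ⁅J ⁅y, z⁆, x⁆ + ⁅J ⁅z, x⁆, y⁆ = 0 := by
    refine (LieAlgebra.IsKilling.killingForm_nondegenerate K M).1 _ fun w => ?_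
    rw [hsymm, hsymm, hsymm]
    simp only [map_add, LinearMap.add_apply, hform]
    rw [← LinearMap.add_apply, ← LinearMap.add_apply, ← map_add, ← map_add, jacobi, map_zero,
      LinearMap.zero_apply]
  refine sub_eq_zero.mp (LieAlgebra.eq_zero_of_forall_lie_eq_zero (K := K) fun z => ?_)
  have k₁ := key x y z
  have k₂ := key y z x
  have k₃ := key z x y
  have h2 : (2 : K) • (⁅J ⁅x, y⁆, z⁆ - ⁅⁅J x, y⁆, z⁆) = 0 := by
    rw [two_smul]
    -- Twice `k₁` plus `hcyc`, compared with `k₁ + k₂ + k₃`.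
    have : (⁅J ⁅x, y⁆, z⁆ + ⁅⁅J z, x⁆, y⁆ + ⁅⁅J y, z⁆, x⁆)
      + (⁅J ⁅x, y⁆, z⁆ + ⁅⁅J z, x⁆, y⁆ + ⁅⁅J y, z⁆, x⁆)
      + (⁅J ⁅x, y⁆, z⁆ + ⁅J ⁅y, z⁆, x⁆ + ⁅J ⁅z, x⁆, y⁆)
      = ((⁅J ⁅x, y⁆, z⁆ + ⁅⁅J z, x⁆, y⁆ + ⁅⁅J y, z⁆, x⁆)
        + (⁅J ⁅y, z⁆, x⁆ + ⁅⁅J x, y⁆, z⁆ + ⁅⁅J z, x⁆, y⁆)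
        + (⁅J ⁅z, x⁆, y⁆ + ⁅⁅J y, z⁆, x⁆ + ⁅⁅J x, y⁆, z⁆))
        + ((⁅J ⁅x, y⁆, z⁆ - ⁅⁅J x, y⁆, z⁆) + (⁅J ⁅x, y⁆, z⁆ - ⁅⁅J x, y⁆, z⁆)) := by abel
    rw [k₁, k₂, k₃, hcyc] at this
    simpa using this.symm
  rw [sub_lie]
  exact (smul_eq_zero.mp h2).resolve_left two_ne_zero

/-- Such an ideal is solvable in two steps, hence lies in the radical, which is the center. -/
theorem LieAlgebra.le_center_of_lie_mem_center {K L : Type*} [CommRing K] [LieRing L]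
    [LieAlgebra K L] [IsNoetherian K L] [LieAlgebra.HasCentralRadical K L] (I : LieIdeal K L)
    (hI : ∀ x ∈ I, ∀ y ∈ I, ⁅x, y⁆ ∈ LieAlgebra.center K L) : I ≤ LieAlgebra.center K L := by
  have hle : LieAlgebra.derivedSeriesOfIdeal K L 1 I ≤ LieAlgebra.center K L := by
    rw [LieAlgebra.derivedSeriesOfIdeal_succ, LieAlgebra.derivedSeriesOfIdeal_zero,
      LieSubmodule.lieIdeal_oper_eq_span, LieSubmodule.lieSpan_le]
    rintro _ ⟨a, b, rfl⟩
    exact hI a a.2 b b.2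
  have hs : LieAlgebra.IsSolvable I := by
    refine LieAlgebra.IsSolvable.mk (R := K) (k := 2)
      ((LieIdeal.derivedSeries_eq_bot_iff I 2).mpr ?_)
    rw [LieAlgebra.derivedSeriesOfIdeal_succ, LieSubmodule.lie_eq_bot_iff]
    intro x hx y _
    exact LieAlgebra.mem_center_iff_lie_eq_zero.mp (hle hx) y
  rw [← LieAlgebra.HasCentralRadical.radical_eq_center (R := K) (L := L)]
  exact (LieIdeal.solvable_iff_le_radical K L I).mp hs

theorem LieAlgebra.hasTrivialRadical_quotient_center {K L : Type*} [CommRing K] [LieRing L]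
    [LieAlgebra K L] [IsNoetherian K L] [LieAlgebra.HasCentralRadical K L] :
    LieAlgebra.HasTrivialRadical K (L ⧸ LieAlgebra.center K L) := by
  rw [LieAlgebra.hasTrivialRadical_iff_no_abelian_ideals]
  intro I hI
  let q : L →ₗ[K] L ⧸ LieAlgebra.center K L := (LieAlgebra.center K L).toSubmodule.mkQ
  have hq (x y : L) : q ⁅x, y⁆ = ⁅q x, q y⁆ := rfl
  have hq0 (x : L) : q x = 0 ↔ x ∈ LieAlgebra.center K L := Submodule.Quotient.mk_eq_zero _
  let N : LieIdeal K L :=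
    { I.toSubmodule.comap q with
      lie_mem := by
        intro x m hm
        change q ⁅x, m⁆ ∈ I
        rw [hq]
        exact lie_mem_right K _ I _ _ hm }
  have hN : N ≤ LieAlgebra.center K L := by
    refine LieAlgebra.le_center_of_lie_mem_center N fun x hx y hy => ?_
    rw [← hq0, hq]
    exact congrArg Subtype.val (hI.trivial (⟨q x, hx⟩ : I) (⟨q y, hy⟩ : I))
  rw [eq_bot_iff]
  intro v hv
  obtain ⟨x, rfl⟩ := (LieAlgebra.center K L).toSubmodule.mkQ_surjective v
  exact (LieSubmodule.mem_bot _).mpr ((hq0 x).mpr (hN hv))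

theorem LieAlgebra.mem_center_of_lie_mem_center {K L : Type*} [CommRing K] [LieRing L]
    [LieAlgebra K L] [IsNoetherian K L] [LieAlgebra.HasCentralRadical K L] {x : L}
    (hx : ∀ y : L, ⁅y, x⁆ ∈ LieAlgebra.center K L) : x ∈ LieAlgebra.center K L := by
  refine LieAlgebra.le_center_of_lie_mem_center (LieAlgebra.center K L).normalizer
    (fun a _ b hb => (LieSubmodule.mem_normalizer _ _).mp hb a)
    ((LieSubmodule.mem_normalizer _ _).mpr hx)

/-- Orthogonality gives only that the preimage of the center under `J` is central; by rank-nullity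
this preimage has dimension at least that of the center, so the two coincide. -/
theorem IsLieOrthogonal.map_mem_center_iff {K L : Type*} [Field K] [LieRing L] [LieAlgebra K L]
    [FiniteDimensional K L] {J : Module.End K L} (hJ : IsLieOrthogonal J) {x : L} :
    J x ∈ LieAlgebra.center K L ↔ x ∈ LieAlgebra.center K L := by
  set Z : Submodule K L := (LieAlgebra.center K L).toSubmodule
  have hle : LinearMap.ker (Z.mkQ ∘ₗ J) ≤ Z := by
    intro y hy
    have hy' : J y ∈ LieAlgebra.center K L := (Submodule.Quotient.mk_eq_zero Z).mp hy
    refine LieAlgebra.mem_center_iff_lie_eq_zero.mpr fun z => ?_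
    rw [← hJ y z]
    exact LieAlgebra.mem_center_iff_lie_eq_zero.mp hy' _
  have heq : LinearMap.ker (Z.mkQ ∘ₗ J) = Z := by
    refine Submodule.eq_of_le_of_finrank_le hle ?_
    have h₁ := LinearMap.finrank_range_add_finrank_ker (Z.mkQ ∘ₗ J)
    have h₂ := Submodule.finrank_le (LinearMap.range (Z.mkQ ∘ₗ J))
    have h₃ := Submodule.finrank_quotient_add_finrank Z
    omega
  exact (Submodule.Quotient.mk_eq_zero Z).symm.trans (SetLike.ext_iff.mp heq x)

/-- A Lie-orthogonal operator on a reductive Lie algebra is, modulo the center, an involution in the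
centroid. -/
theorem IsLieOrthogonal.centroid_involution_mod_center {K L : Type*} [Field K] [CharZero K]
    [LieRing L] [LieAlgebra K L] [FiniteDimensional K L] [LieAlgebra.HasCentralRadical K L]
    {J : Module.End K L} (hJ : IsLieOrthogonal J) :
    (∀ x y : L, J ⁅x, y⁆ - ⁅J x, y⁆ ∈ LieAlgebra.center K L) ∧
      ∀ x : L, J (J x) - x ∈ LieAlgebra.center K L := by
  set Z := LieAlgebra.center K L
  let J' : Module.End K (L ⧸ Z) :=
    Submodule.mapQ Z.toSubmodule Z.toSubmodule J fun x hx => hJ.map_mem_center_iff.mpr hx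
  let q : L →ₗ[K] L ⧸ Z := Z.toSubmodule.mkQ
  have hq (x y : L) : q ⁅x, y⁆ = ⁅q x, q y⁆ := rfl
  have hJq (x : L) : J' (q x) = q (J x) := rfl
  have hqs : Function.Surjective q := Z.toSubmodule.mkQ_surjective
  have hq0 (x : L) : q x = 0 ↔ x ∈ Z := Submodule.Quotient.mk_eq_zero _
  have := LieAlgebra.hasTrivialRadical_quotient_center (K := K) (L := L)
  have hJ' : IsLieOrthogonal J' := by
    intro x y
    obtain ⟨x, rfl⟩ := hqs x
    obtain ⟨y, rfl⟩ := hqs y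
    rw [hJq, hJq, ← hq, ← hq, hJ]
  obtain ⟨h₁, h₂⟩ := hJ'.centroid_involution
  constructor
  · intro x y
    rw [← hq0, map_sub, hq, ← hJq, ← hJq, hq, h₁, sub_self]
  · intro x
    rw [← hq0, map_sub, ← hJq, ← hJq, h₂, sub_self]

theorem IsLieOrthogonal.sign_on_simple_ideal {K L : Type*} [Field K] [CharZero K]
    [LieRing L] [LieAlgebra K L] [FiniteDimensional K L] [LieAlgebra.HasCentralRadical K L]
    {J : Module.End K L} (hJ : IsLieOrthogonal J) (I : LieIdeal K L)
    (hI : LieAlgebra.IsSimple K I) :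
    (∀ x ∈ I, J x - x ∈ LieAlgebra.center K L) ∨ ∀ x ∈ I, J x + x ∈ LieAlgebra.center K L := by
  obtain ⟨h₁, h₂⟩ := hJ.centroid_involution_mod_center
  set Z := LieAlgebra.center K L
  have h₁' (x y : L) : J ⁅x, y⁆ - ⁅x, J y⁆ ∈ Z := by
    have h := neg_mem (h₁ y x)
    rw [← lie_skew x y, ← lie_skew x (J y), map_neg]
    convert h using 1
    abel
  have hc {z : L} (hz : z ∈ Z) (y : L) : ⁅z, y⁆ = 0 :=
    LieAlgebra.mem_center_iff_lie_eq_zero.mp hz y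
  let N : LieIdeal K I :=
    { Z.toSubmodule.comap ((J - LinearMap.id) ∘ₗ I.toSubmodule.subtype) with
      lie_mem := by
        intro x m hm
        change J m - m ∈ Z at hm
        change J ⁅(x : L), (m : L)⁆ - ⁅(x : L), (m : L)⁆ ∈ Z
        have e : J ⁅(x : L), (m : L)⁆ - ⁅(x : L), (m : L)⁆ =
            (J ⁅(x : L), (m : L)⁆ - ⁅(x : L), J m⁆) + ⁅(x : L), J m - m⁆ := by
          rw [lie_sub]
          abel
        rw [e]
        exact add_mem (h₁' _ _) (lie_mem_right K L Z _ _ hm) }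
  have hN (x : I) : x ∈ N ↔ J x - x ∈ Z := Iff.rfl
  rcases hI.eq_bot_or_eq_top N with hbot | htop
  · right
    intro x hx
    refine LieAlgebra.mem_center_of_lie_mem_center fun y => ?_
    -- `J` need not preserve `I`, but bracketing with `x` lands in `I`. As `J ^ 2 = 1` modulo `Z`,
    -- `J y + y` is fixed by `J` modulo `Z`; by the centroid property so is the bracket, which
    -- therefore lies in `N = ⊥`.
    have hw : ⁅J y + y, x⁆ ∈ I := lie_mem_right K L I _ _ hx
    have hwN : (⟨_, hw⟩ : I) ∈ N := by
      rw [hN]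
      have e : J ⁅J y + y, x⁆ - ⁅J y + y, x⁆ =
          (J ⁅J y + y, x⁆ - ⁅J (J y + y), x⁆) + ⁅J (J y) - y, x⁆ := by
        simp only [map_add, add_lie, sub_lie]
        abel
      change J ⁅J y + y, x⁆ - ⁅J y + y, x⁆ ∈ Z
      rw [e, hc (h₂ y), add_zero]
      exact h₁ _ _
    rw [hbot, LieSubmodule.mem_bot] at hwN
    have hw0 : ⁅J y + y, x⁆ = 0 := congrArg Subtype.val hwN
    have e : ⁅y, J x + x⁆ = (J ⁅y, x⁆ - ⁅J y, x⁆) - (J ⁅y, x⁆ - ⁅y, J x⁆) + ⁅J y + y, x⁆ := by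
      simp only [lie_add, add_lie]
      abel
    rw [e, hw0, add_zero]
    exact sub_mem (h₁ y x) (h₁' y x)
  · left
    intro x hx
    exact (hN ⟨x, hx⟩).mp (htop ▸ LieSubmodule.mem_top _)

theorem corollary11 {K L : Type*} [Field K] [CharZero K] [LieRing L] [LieAlgebra K L]
    [FiniteDimensional K L] [LieAlgebra.HasCentralRadical K L]
    {k : ℕ} (S : Fin k → LieIdeal K L) (hS : ∀ i, LieAlgebra.IsSimple K (S i))
    (hdec : DirectSum.IsInternal fun o => (centerAndComponents K S o).toSubmodule)
    (J : Module.End K L) :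
    IsLieOrthogonal J ↔
      ∃ (Jc : ∀ o, Module.End K (centerAndComponents K S o).toSubmodule) (JZ : Module.End K L),
        Jc none = 0 ∧
        (∀ i : Fin k, Jc (some i) = LinearMap.id ∨ Jc (some i) = -LinearMap.id) ∧
        (∀ x, JZ x ∈ LieAlgebra.center K L) ∧
        J = directSumOperator hdec Jc + JZ := by
  have hdisj {o p : Option (Fin k)} (h : o ≠ p) {x : L} (hx : x ∈ centerAndComponents K S o)
      (hx' : x ∈ centerAndComponents K S p) : x = 0 :=
    Submodule.disjoint_def.mp (hdec.submodule_iSupIndep.pairwiseDisjoint h) x hx hx'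
  have hind {P : L → Prop} (h0 : P 0) (hadd : ∀ x y, P x → P y → P (x + y))
      (hmem : ∀ o, ∀ x ∈ centerAndComponents K S o, P x) (x : L) : P x := by
    have hx : x ∈ ⨆ o, (centerAndComponents K S o).toSubmodule := by
      rw [hdec.submodule_iSup_eq_top]
      exact Submodule.mem_top
    exact Submodule.iSup_induction _ (motive := P) hx hmem h0 hadd
  constructor
  · intro hJ
    classical
    have hsign (i : Fin k) := hJ.sign_on_simple_ideal (S i) (hS i)
    let Jc : ∀ o, Module.End K (centerAndComponents K S o).toSubmodule := fun o =>
      match o with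
      | none => 0
      | some i => if ∀ x ∈ S i, J x - x ∈ LieAlgebra.center K L then LinearMap.id
          else -LinearMap.id
    refine ⟨Jc, J - directSumOperator hdec Jc, rfl, fun i => ?_, ?_, (add_sub_cancel _ _).symm⟩
    · exact ite_eq_or_eq _ _ _
    · refine hind (by simp) (fun x y hx hy => ?_) fun o x hx => ?_
      · rw [map_add]
        exact add_mem hx hy
      · have hD := directSumOperator_apply hdec Jc o ⟨x, hx⟩
        change directSumOperator hdec Jc x = _ at hD
        rw [LinearMap.sub_apply, hD]
        match o with
        | none =>
          change J x - 0 ∈ _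
          rw [sub_zero]
          exact hJ.map_mem_center_iff.mpr hx
        | some i =>
          by_cases h : ∀ x ∈ S i, J x - x ∈ LieAlgebra.center K L
          · have hJc : Jc (some i) = LinearMap.id := if_pos h
            rw [hJc]
            exact h x hx
          · have hJc : Jc (some i) = -LinearMap.id := if_neg h
            rw [hJc]
            change J x - -x ∈ _
            rw [sub_neg_eq_add]
            exact (hsign i).resolve_left h x hx
  · rintro ⟨Jc, JZ, h0, h1, hZ, rfl⟩
    set D := directSumOperator hdec Jc
    have hc {z : L} (hz : z ∈ LieAlgebra.center K L) (y : L) : ⁅z, y⁆ = 0 :=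
      LieAlgebra.mem_center_iff_lie_eq_zero.mp hz y
    have hc' {z : L} (hz : z ∈ LieAlgebra.center K L) (y : L) : ⁅y, z⁆ = 0 := by
      rw [← lie_skew, hc hz, neg_zero]
    have hD0 {x : L} (hx : x ∈ LieAlgebra.center K L) : D x = 0 := by
      have h := directSumOperator_apply hdec Jc none ⟨x, hx⟩
      rw [h0] at h
      exact h
    have hD1 (i : Fin k) : (∀ x ∈ S i, D x = x) ∨ ∀ x ∈ S i, D x = -x := by
      refine (h1 i).imp (fun h x hx => ?_) fun h x hx => ?_ <;>
      · have h' := directSumOperator_apply hdec Jc (some i) ⟨x, hx⟩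
        rw [h] at h'
        exact h'
    have hD (x y : L) : ⁅D x, D y⁆ = ⁅x, y⁆ := by
      refine hind (P := fun x => ⁅D x, D y⁆ = ⁅x, y⁆) (by simp)
        (fun a b ha hb => by rw [map_add, add_lie, add_lie, ha, hb]) (fun o x hx => ?_) x
      refine hind (P := fun y => ⁅D x, D y⁆ = ⁅x, y⁆) (by simp)
        (fun a b ha hb => by rw [map_add, lie_add, lie_add, ha, hb]) (fun p y hy => ?_) y
      match o, p with
      | none, _ => rw [hD0 hx, hc hx, zero_lie]
      | _, none => rw [hD0 hy, hc' hy, lie_zero]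
      | some i, some j =>
        by_cases hij : i = j
        · subst hij
          rcases hD1 i with h | h
          · rw [h x hx, h y hy]
          · rw [h x hx, h y hy, neg_lie, lie_neg, neg_neg]
        -- Distinct components commute: the bracket lies in both ideals.
        · have hxy : ⁅x, y⁆ = 0 :=
            hdisj (fun h => hij (Option.some.inj h)) (lie_mem_left K L (S i) x y hx)
              (lie_mem_right K L (S j) x y hy)
          rcases hD1 i with h | h <;> rcases hD1 j with h' | h' <;>
            simp [h x hx, h' y hy, hxy]
    intro x y
    rw [LinearMap.add_apply, LinearMap.add_apply, lie_add, add_lie, add_lie, hc (hZ x),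
      hc (hZ x), hc' (hZ y), hD, add_zero, add_zero, add_zero]
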